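/- A $\beta(1,0)$-tree is a finite rooted plane tree whose nodes are labelled with positive integers such that every leaf has label $1$, the label of the root (unless the root is a leaf) is the sum of the labels of its children, and every other internal node has label at most the sum of the labels of its children. A node has \emph{maximum label} if its label is the largest that these conditions permit, given its children: $1$ for a leaf and the sum of the labels of the children for an internal node. A rooted map has a distinguished directed root edge; its tail is the root vertex, and the face to the right of it is the root-face, drawn as the outer face. Rooted maps are considered up to root-preserving isomorphism (orientation-preserving homeomorphism). To a $\beta(1,0)$-tree $T$ one associates a rooted non-separable planar map as follows (the Cori--Jacquard--Schaeffer bijection), working from the leaves to the root. A leaf is assigned the map with a single edge joining two vertices. For an internal node whose children, from left to right, are assigned the maps $1,\dots,m$, glue (in the outer face) the starred vertex of map $j$ to the root vertex of map $j+1$ for $1\le j<m$, and then add in the outer face a new edge, directed from the starred vertex of map $m$ to the root vertex of map $1$, as the new root edge, so that the part of the old outer boundary running counterclockwise from the root vertex of map $1$ to the starred vertex of map $m$ stays on the outer face. In the map assigned to a non-root node (leaf or internal) with label $i$, the starred vertex is the $i$-th vertex after the root vertex in counterclockwise direction on the outer face. The map associated with $T$ is the one assigned to its root. An internal $2$-face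 of a rooted map is a face of degree $2$ other than the root-face. A map is \emph{primitive} if it has no internal $2$-face, and a $\beta(1,0)$-tree is \emph{primitive} if it corresponds to a primitive map. \textbf{Proposition.} A $\beta(1,0)$-tree is primitive if and only if it has no node which has exactly one child such that this child has maximum label. Moreover, the number of internal $2$-faces of the map corresponding to a $\beta(1,0)$-tree equals the number of nodes of the tree (necessarily different from the root) that are the only child of their parent and have maximum label. -/

import Mathlib

open Equiv

/-! ### Rooted maps -/

/-- A rooted map on an oriented surface, encoded by its rotation system. The darts are the directed
edges. The permutation `rot` sends a dart to the next dart, counterclockwise, with the same tail;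
`inv` reverses a dart; `root` is the distinguished directed edge. -/
structure RootedMap where
  Dart : Type
  [fintypeDart : Fintype Dart]
  [decEqDart : DecidableEq Dart]
  rot : Perm Dart
  inv : Perm Dart
  inv_inv : ∀ d, inv (inv d) = d
  inv_ne : ∀ d, inv d ≠ d
  root : Dart

namespace RootedMap

attribute [instance] RootedMap.fintypeDart RootedMap.decEqDart

/-- The dart that follows `d` on the boundary of the face to the right of `d`. -/
def next (M : RootedMap) : Perm M.Dart := M.rot * M.inv

/-- A face is a cycle of `next`: the directed edges that have this face on their right. -/
def Face (M : RootedMap) : Type := Quotient (Perm.SameCycle.setoid M.next)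

/-- The face to the right of a dart. -/
def faceOf (M : RootedMap) (d : M.Dart) : M.Face := Quotient.mk (Perm.SameCycle.setoid M.next) d

/-- The face to the right of the root, which is drawn as the outer face. -/
def rootFace (M : RootedMap) : M.Face := M.faceOf M.root

/-- The degree of a face: the number of directed edges on its boundary. -/
noncomputable def faceDegree (M : RootedMap) (f : M.Face) : ℕ := {d : M.Dart | M.faceOf d = f}.ncard

/-- The faces of degree two other than the root face. -/
def internalTwoFaces (M : RootedMap) : Set M.Face := {f | f ≠ M.rootFace ∧ M.faceDegree f = 2}

/-- A primitive map has no internal face of degree two; its root face may have degree two. -/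
def IsPrimitive (M : RootedMap) : Prop := M.internalTwoFaces = ∅

/-- Two rooted maps are the same if a bijection of their darts respects all the data, that is, if
they differ by an orientation-preserving homeomorphism that maps root to root. -/
def Iso (M N : RootedMap) : Prop :=
  ∃ e : M.Dart ≃ N.Dart,
    (∀ d, e (M.rot d) = N.rot (e d)) ∧ (∀ d, e (M.inv d) = N.inv (e d)) ∧ e M.root = N.root

/-- The map with one edge, joining two distinct vertices. -/
def link : RootedMap where
  Dart := Bool
  rot := 1
  inv := boolNot
  inv_inv := by decide
  inv_ne := by decide
  root := true

end RootedMap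

/-- A rooted map together with a star. The star is a corner of the outer face, recorded by the dart
that leaves this corner and has the outer face on its right; the starred vertex is its tail. (The
root dart records the corner of the outer face at the root vertex in the same way.) -/
structure StarredMap extends RootedMap where
  star : Dart

/-- Puts the star on the `i`-th vertex that one meets when walking counterclockwise on the outer
face from the root vertex, which is not counted. -/
def RootedMap.mark (M : RootedMap) (i : ℕ) : StarredMap :=
  { M with star := (M.next ^ i) M.root }

namespace StarredMap

/-- Places two maps next to each other and identifies the starred vertex of the first with the root
vertex of the second, inside the outer face: the rotation arrives at the corner of the star of `M`
and continues with the darts at the root vertex of `N`, then with the remaining darts of `M`.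
The root is that of the first map and the star is that of the second. -/
def glue (M N : StarredMap) : StarredMap where
  Dart := M.Dart ⊕ N.Dart
  rot := swap (Sum.inl M.star) (Sum.inr N.root) * Perm.sumCongr M.rot N.rot
  inv := Perm.sumCongr M.inv N.inv
  inv_inv := by rintro (d | d) <;> simp [M.inv_inv, N.inv_inv]
  inv_ne := by rintro (d | d) <;> simp [M.inv_ne, N.inv_ne]
  root := Sum.inl M.root
  star := Sum.inr N.star

/-- Glues the maps of a nonempty list into a chain, from left to right. -/
def glueChain : StarredMap → List StarredMap → StarredMap
  | M, [] => M
  | M, N :: Ns => glue M (glueChain N Ns)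

/-- Adds a new edge in the outer face, directed from the starred vertex to the root vertex, and
makes it the root. Its two darts are `inr true` (the new root, inserted in the rotation at the
corner of the star) and `inr false` (inserted at the corner of the old root). The new outer face
consists of the new root and of the part of the old outer face from the old root vertex,
counterclockwise, to the star. -/
def addRootEdge (M : StarredMap) : RootedMap where
  Dart := M.Dart ⊕ Bool
  rot := swap (Sum.inl M.star) (Sum.inr true) * swap (Sum.inl M.root) (Sum.inr false) *
    Perm.sumCongr M.rot 1
  inv := Perm.sumCongr M.inv boolNot
  inv_inv := by rintro (d | d) <;> simp [M.inv_inv]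
  inv_ne := by rintro (d | d) <;> simp [M.inv_ne]
  root := Sum.inr true

/-- The map at a node whose children are assigned the given starred maps, from left to right. A leaf
is assigned the link. -/
def assemble : List StarredMap → RootedMap
  | [] => RootedMap.link
  | M :: Ms => (glueChain M Ms).addRootEdge

end StarredMap

/-! ### Trees -/

/-- Finite rooted plane trees whose nodes are labelled with natural numbers; the children of a node
are ordered from left to right. -/
inductive LTree where
  | node (label : ℕ) (children : List LTree)

namespace LTree

def label : LTree → ℕ
  | node l _ => l

def children : LTree → List LTree
  | node _ cs => cs

/-- The sum of the labels of the children of the root. -/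
def childSum (t : LTree) : ℕ := (t.children.map label).sum

/-- The subtree rooted at the node with address `p`, if there is such a node. The root has address
`[]` and the `i`-th child (from `0`) of the node with address `p` has address `p ++ [i]`. -/
def subtreeAt : LTree → List ℕ → Option LTree
  | t, [] => some t
  | t, i :: p => (t.children[i]?).bind fun c => c.subtreeAt p

/-- `β(1,0)`-trees: the labels are positive, the leaves have label `1`, the root (if it is not a
leaf) has label equal to the sum of the labels of its children, and every other internal node has
label at most the sum of the labels of its children. -/
structure IsBetaTree (T : LTree) : Prop where
  pos : ∀ p t, T.subtreeAt p = some t → 0 < t.label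
  leaf : ∀ p t, T.subtreeAt p = some t → t.children = [] → t.label = 1
  root : T.children ≠ [] → T.label = T.childSum
  le : ∀ p t, p ≠ [] → T.subtreeAt p = some t → t.children ≠ [] → t.label ≤ t.childSum

/-- The root of the subtree `t` has the largest label that a node with these children can have:
`1` for a leaf, and the sum of the labels of the children otherwise. -/
def HasMaxLabel (t : LTree) : Prop :=
  if t.children = [] then t.label = 1 else t.label = t.childSum

/-- The node `p` of `T` has exactly one child, and this child has maximum label. -/
def HasSingleMaxChild (T : LTree) (p : List ℕ) : Prop :=
  ∃ v u, T.subtreeAt p = some v ∧ v.children = [u] ∧ u.HasMaxLabel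

/-- The node `q` of `T` is a single child with maximum label: it is the only child of its parent
`p`, and it has maximum label. (The root has no parent.) -/
def IsSingleMaxChild (T : LTree) (q : List ℕ) : Prop :=
  ∃ p, q = p ++ [0] ∧ T.HasSingleMaxChild p

mutual

/-- The rooted map obtained from a tree by the recursive construction: glue the starred maps of the
children into a chain, and close the chain with a new root edge. -/
def toMap : LTree → RootedMap
  | node _ cs => StarredMap.assemble (starredMaps cs)

/-- The starred maps of a list of siblings: the star of the map at a node with label `i` is placed
on the `i`-th vertex after the root vertex, counterclockwise on the outer face. -/
def starredMaps : List LTree → List StarredMap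
  | [] => []
  | c :: cs => c.toMap.mark c.label :: starredMaps cs

end

/-- The correspondence between trees and rooted maps, the latter taken up to isomorphism. -/
def CorrespondsTo (T : LTree) (M : RootedMap) : Prop := M.Iso T.toMap

/-- A tree is primitive if it corresponds to a primitive map. -/
def IsPrimitive (T : LTree) : Prop := ∃ M : RootedMap, T.CorrespondsTo M ∧ M.IsPrimitive

end LTree

-- Faces are cycles of `next`, and an internal 2-face is a 2-cycle that avoids the root dart. Each
-- step of the construction alters only the root-face cycle, which the star cuts into a forward path
-- (root to star) and a return path (star to root).
--
-- Gluing joins two root-face cycles into one: the forward paths are concatenated, so are the return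
-- paths, and no internal face changes (`merge`, `ncard_twoCyclePoints_merge`). The new root edge
-- cuts the cycle in two: the forward path and one new dart bound the new root face, while the
-- return path and the other new dart bound a single new internal face
-- (`ncard_twoCyclePoints_split`).
--
-- By induction on the tree (`MapInvariant`), the root face at a node has degree one more than the
-- largest label allowed there. So a child with label `i` and largest allowed label `m` has a
-- forward path of length `i` and a return path of length `m + 1 - i ≥ 1`, with equality exactly at
-- maximum label. The new internal face has degree one plus the sum of the return lengths; it is a
-- 2-face iff there is exactly one child and this child has maximum label.

-- Orbits written as explicit lists

/-- `l` lists the points that the iteration of `σ` meets on its way from `x` to `y`, the last one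
excluded. -/
def IsPath {α : Type*} (σ : α → α) : α → List α → α → Prop
  | x, [], y => x = y
  | x, a :: l, y => x = a ∧ IsPath σ (σ a) l y

namespace IsPath

variable {α β : Type*} {σ : α → α} {x y z d : α} {l l' : List α}

theorem append_iff : IsPath σ x (l ++ l') z ↔ ∃ y, IsPath σ x l y ∧ IsPath σ y l' z := by
  induction l generalizing x with
  | nil => simp [IsPath]
  | cons a l ih => simp [IsPath, ih, and_assoc]

theorem append (h : IsPath σ x l y) (h' : IsPath σ y l' z) : IsPath σ x (l ++ l') z :=
  append_iff.2 ⟨y, h, h'⟩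

theorem iterate_eq (h : IsPath σ x l y) : σ^[l.length] x = y := by
  induction l generalizing x with
  | nil => exact h
  | cons a l ih => obtain ⟨rfl, h⟩ := h; exact ih h

theorem start_mem (h : IsPath σ x l y) (hl : l ≠ []) : x ∈ l := by
  cases l with
  | nil => exact absurd rfl hl
  | cons a l => simp [h.1]

/-- The tail, rather than `l`, appears because in a duplicate-free path it omits the starting point;
this yields `apply_ne_start`. -/
theorem mem_tail_or (h : IsPath σ x l y) (hd : d ∈ l) : σ d ∈ l.tail ∨ σ d = y := by
  induction l generalizing x with
  | nil => simp at hd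
  | cons a l ih =>
    obtain ⟨rfl, h⟩ := h
    rcases List.mem_cons.1 hd with rfl | hd
    · cases l with
      | nil => exact Or.inr h
      | cons b l => left; simp [h.1]
    · exact (ih h hd).imp_left List.mem_of_mem_tail

theorem start_notMem_tail (h : IsPath σ x l y) (hl : l.Nodup) : x ∉ l.tail := by
  cases l with
  | nil => simp
  | cons a l => rw [h.1]; exact (List.nodup_cons.1 hl).1

theorem apply_ne_start (h : IsPath σ x l y) (hl : l.Nodup) (hxy : y ≠ x) (hd : d ∈ l) :
    σ d ≠ x := by
  rintro rfl
  exact (h.mem_tail_or hd).elim (h.start_notMem_tail hl) fun e => hxy e.symm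

theorem map {f : α → β} {τ : β → β} (h : IsPath σ x l y) (hf : ∀ d ∈ l, τ (f d) = f (σ d)) :
    IsPath τ (f x) (l.map f) (f y) := by
  induction l generalizing x with
  | nil => exact congrArg f h
  | cons a l ih =>
    obtain ⟨rfl, h⟩ := h
    refine ⟨rfl, ?_⟩
    rw [hf _ (by simp)]
    exact ih h fun d hd => hf d (List.mem_cons_of_mem _ hd)

/-- The image of a path under a map that is compatible with the steps, except that the last step
is redirected. -/
theorem map_redirect {f : α → β} {τ : β → β} {w : β} (h : IsPath σ x l y) (hl : l ≠ [])
    (hy : y ∉ l) (hf : ∀ d ∈ l, σ d ≠ y → τ (f d) = f (σ d)) (hw : ∀ d ∈ l, σ d = y → τ (f d) = w) :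
    IsPath τ (f x) (l.map f) w := by
  induction l generalizing x with
  | nil => exact absurd rfl hl
  | cons a l ih =>
    obtain ⟨rfl, h⟩ := h
    refine ⟨rfl, ?_⟩
    cases l with
    | nil => exact hw x (by simp) h
    | cons b l =>
      have hb : σ x ≠ y := fun e => hy (by simp [← e, h.1])
      rw [hf x (by simp) hb]
      exact ih h (by simp) (fun e => hy (List.mem_cons_of_mem _ e))
        (fun d hd => hf d (List.mem_cons_of_mem _ hd))
        (fun d hd => hw d (List.mem_cons_of_mem _ hd))

/-- A closed path is stable under `σ`, and on a finite type natural powers already exhaust a cycle.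
Repetitions in `l` do no harm. -/
theorem sameCycle_iff_mem [Finite α] {σ : Perm α} (h : IsPath σ x l x) (hl : l ≠ []) :
    σ.SameCycle x d ↔ d ∈ l := by
  constructor
  · intro hd
    obtain ⟨i, rfl⟩ := hd.exists_nat_pow_eq
    clear hd
    induction i with
    | zero => exact h.start_mem hl
    | succ i ih =>
      rw [pow_succ', Perm.mul_apply]
      rcases h.mem_tail_or ih with h' | h'
      · exact List.mem_of_mem_tail h'
      · rw [h']; exact h.start_mem hl
  · intro hd
    obtain ⟨s, t, rfl⟩ := List.append_of_mem hd
    obtain ⟨y, h₁, h₂⟩ := append_iff.1 h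
    obtain rfl := h₂.1
    refine ⟨(s.length : ℤ), ?_⟩
    rw [zpow_natCast, Perm.coe_pow]
    exact h₁.iterate_eq

end IsPath

-- Cycles of length two

/-- Makes "degree two" a local condition on a dart, easy to compare between two permutations that
agree near that dart. -/
theorem ncard_sameCycle_eq_two_iff {α : Type*} [Finite α] (σ : Perm α) (d : α) :
    {y | σ.SameCycle d y}.ncard = 2 ↔ σ d ≠ d ∧ σ (σ d) = d := by
  have h₁ : σ.SameCycle d (σ d) := ⟨1, by simp⟩
  have h₂ : σ.SameCycle d (σ (σ d)) := ⟨2, by rw [zpow_ofNat, pow_two, Perm.mul_apply]⟩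
  constructor
  · intro h
    have hne : σ d ≠ d := by
      intro e
      have hp : IsPath σ d [d] d := ⟨rfl, e⟩
      have : {y | σ.SameCycle d y} = {d} := by
        ext y; simp [hp.sameCycle_iff_mem]
      rw [this, Set.ncard_singleton] at h
      omega
    refine ⟨hne, ?_⟩
    have hsub : ({d, σ d} : Set α) ⊆ {y | σ.SameCycle d y} := by
      rintro y (rfl | rfl)
      · exact Perm.SameCycle.refl _ _
      · exact h₁
    have heq := Set.eq_of_subset_of_ncard_le hsub (by rw [h, Set.ncard_pair hne.symm])
    have : σ (σ d) ∈ ({d, σ d} : Set α) := by rw [heq]; exact h₂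
    rcases this with h | h
    · exact h
    · exact absurd (σ.injective h) hne
  · rintro ⟨hne, e⟩
    have hp : IsPath σ d [d, σ d] d := ⟨rfl, rfl, e⟩
    have : {y | σ.SameCycle d y} = {d, σ d} := by
      ext y; simp [hp.sameCycle_iff_mem]
    rw [this, Set.ncard_pair hne.symm]

theorem IsPath.two_step_iff {α : Type*} [Finite α] {σ : Perm α} {x d : α} {l : List α}
    (h : IsPath σ x l x) (hl : l ≠ []) (hn : l.Nodup) (hd : d ∈ l) :
    (σ d ≠ d ∧ σ (σ d) = d) ↔ l.length = 2 := by
  classical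
  rw [← ncard_sameCycle_eq_two_iff]
  have hxd := (h.sameCycle_iff_mem hl).2 hd
  have : {y | σ.SameCycle d y} = (l.toFinset : Set α) := by
    ext y
    simp only [Set.mem_ofPred_eq, List.coe_toFinset]
    rw [← h.sameCycle_iff_mem hl]
    exact ⟨hxd.trans, hxd.symm.trans⟩
  rw [this, Set.ncard_coe_finset, List.toFinset_card_of_nodup hn]

/-- The points of the cycles of length two of `σ` that do not contain `x`. -/
def twoCyclePoints {α : Type*} (σ : Perm α) (x : α) : Set α :=
  {d | ¬ σ.SameCycle x d ∧ σ d ≠ d ∧ σ (σ d) = d}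

-- Counting internal 2-faces by their darts

namespace RootedMap

/-- The darts that bound an internal face of degree two. -/
def internalTwoDarts (M : RootedMap) : Set M.Dart := twoCyclePoints M.next M.root

theorem faceOf_eq_iff (M : RootedMap) {d d' : M.Dart} :
    M.faceOf d = M.faceOf d' ↔ M.next.SameCycle d d' :=
  Quotient.eq (r := Perm.SameCycle.setoid M.next)

instance (M : RootedMap) : Finite M.Face :=
  Quotient.finite (Perm.SameCycle.setoid M.next)

theorem faceOf_mem_internalTwoFaces (M : RootedMap) (d : M.Dart) :
    M.faceOf d ∈ M.internalTwoFaces ↔ d ∈ M.internalTwoDarts := by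
  have hcard : M.faceDegree (M.faceOf d) = 2 ↔ M.next d ≠ d ∧ M.next (M.next d) = d := by
    rw [← ncard_sameCycle_eq_two_iff, faceDegree]
    simp only [faceOf_eq_iff, Perm.sameCycle_comm (y := d)]
  have hroot : M.faceOf d ≠ M.rootFace ↔ ¬ M.next.SameCycle M.root d := by
    rw [rootFace, ne_eq, faceOf_eq_iff, Perm.sameCycle_comm]
  exact and_congr hroot hcard

/-- The fibre of `faceOf` over each internal 2-face has two elements. Counting darts avoids
comparing quotients of different dart types. -/
theorem ncard_internalTwoDarts (M : RootedMap) :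
    M.internalTwoDarts.ncard = 2 * M.internalTwoFaces.ncard := by
  classical
  have := Fintype.ofFinite M.Face
  rw [Set.ncard_eq_toFinset_card' M.internalTwoDarts, Set.ncard_eq_toFinset_card' M.internalTwoFaces,
    Finset.card_eq_sum_card_fiberwise (f := M.faceOf) (t := M.internalTwoFaces.toFinset)]
  · rw [Finset.sum_const_nat (m := 2), mul_comm]
    intro f hf
    have hf' := Set.mem_toFinset.1 hf
    rw [← hf'.2, faceDegree, Set.ncard_eq_toFinset_card']
    congr 1
    ext d
    simp only [Finset.mem_filter, Set.mem_toFinset, Set.mem_ofPred_eq]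
    refine ⟨And.right, fun h => ⟨?_, h⟩⟩
    rw [← M.faceOf_mem_internalTwoFaces, h]
    exact hf'
  · intro d hd
    simpa [M.faceOf_mem_internalTwoFaces] using hd

theorem Iso.ncard_internalTwoFaces {M N : RootedMap} (h : M.Iso N) :
    M.internalTwoFaces.ncard = N.internalTwoFaces.ncard := by
  obtain ⟨e, hrot, hinv, hroot⟩ := h
  have hnext : ∀ d, e (M.next d) = N.next (e d) := fun d => by
    simp only [next, Perm.mul_apply, hrot, hinv]
  have hpow : ∀ (n : ℕ) d, e ((M.next ^ n) d) = (N.next ^ n) (e d) := fun n d => by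
    simp only [Perm.coe_pow]
    exact Function.Semiconj.iterate_right (f := e) hnext n d
  have hcycle : ∀ d, M.next.SameCycle M.root d ↔ N.next.SameCycle N.root (e d) := by
    intro d
    constructor
    · intro h
      obtain ⟨n, rfl⟩ := h.exists_nat_pow_eq
      exact ⟨n, by rw [hpow, hroot, zpow_natCast]⟩
    · intro h
      obtain ⟨n, hn⟩ := h.exists_nat_pow_eq
      refine ⟨n, e.injective ?_⟩
      rw [zpow_natCast, hpow, hroot, hn]
  have : N.internalTwoDarts = e '' M.internalTwoDarts := by
    ext d
    obtain ⟨d, rfl⟩ := e.surjective d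
    rw [e.injective.mem_set_image]
    simp only [internalTwoDarts, twoCyclePoints, Set.mem_ofPred_eq, hcycle, ne_eq, ← hnext, e.injective.eq_iff]
  have hcard := congrArg Set.ncard this
  rw [Set.ncard_image_of_injective _ e.injective, ncard_internalTwoDarts,
    ncard_internalTwoDarts] at hcard
  omega

end RootedMap

-- Joining and cutting the root-face cycle

/-- The cycle of `σ` through `x` consists of the path `l₁` from `x` to `s` and of the path `l₂` from
`s` to `x`, both nonempty. -/
structure IsSplitCycle {α : Type*} (σ : α → α) (x s : α) (l₁ l₂ : List α) : Prop where
  path₁ : IsPath σ x l₁ s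
  path₂ : IsPath σ s l₂ x
  nodup : (l₁ ++ l₂).Nodup
  ne_nil₁ : l₁ ≠ []
  ne_nil₂ : l₂ ≠ []

namespace IsSplitCycle

section Basic

variable {α : Type*} {σ : α → α} {x s : α} {l₁ l₂ : List α} (h : IsSplitCycle σ x s l₁ l₂)
include h

theorem nodup₁ : l₁.Nodup := (List.nodup_append.1 h.nodup).1

theorem nodup₂ : l₂.Nodup := (List.nodup_append.1 h.nodup).2.1

theorem notMem_of_mem {d : α} (hd : d ∈ l₁) : d ∉ l₂ :=
  List.disjoint_of_nodup_append h.nodup hd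

theorem start_mem : x ∈ l₁ := h.path₁.start_mem h.ne_nil₁

theorem mid_mem : s ∈ l₂ := h.path₂.start_mem h.ne_nil₂

theorem start_notMem : x ∉ l₂ := h.notMem_of_mem h.start_mem

theorem mid_notMem : s ∉ l₁ := fun hs => h.notMem_of_mem hs h.mid_mem

theorem mid_ne_start : s ≠ x := fun e => h.mid_notMem (e ▸ h.start_mem)

theorem path : IsPath σ x (l₁ ++ l₂) x := h.path₁.append h.path₂

end Basic

section Perm

variable {α : Type*} [Finite α] {σ : Perm α} {x s : α} {l₁ l₂ : List α}
  (h : IsSplitCycle σ x s l₁ l₂)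
include h

theorem sameCycle_iff {d : α} : σ.SameCycle x d ↔ d ∈ l₁ ∨ d ∈ l₂ := by
  rw [h.path.sameCycle_iff_mem (by simp [h.ne_nil₁]), List.mem_append]

/-- A cycle is also stable under `σ⁻¹`, so nothing outside enters it. Hence redirecting arrows into
points of the cycle is invisible outside. -/
theorem apply_ne_of_notMem {d d' : α} (hd : ¬ (d ∈ l₁ ∨ d ∈ l₂)) (hd' : d' ∈ l₁ ∨ d' ∈ l₂) :
    σ d ≠ d' := by
  rintro rfl
  rw [← h.sameCycle_iff] at hd hd'
  exact hd (Perm.sameCycle_apply_right.1 hd')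

end Perm

section Glue

variable {α β : Type*} [DecidableEq α] [DecidableEq β] {σ : Perm α} {τ : Perm β} {x s : α} {y t : β}
  {l₁ l₂ : List α} {r₁ r₂ : List β} {ρ : Perm (α ⊕ β)}
  (h : IsSplitCycle σ x s l₁ l₂) (h' : IsSplitCycle τ y t r₁ r₂)
  (hl : ∀ d, ρ (Sum.inl d) = if σ d = s then Sum.inr y else Sum.inl (σ d))
  (hr : ∀ d, ρ (Sum.inr d) = if τ d = y then Sum.inl s else Sum.inr (τ d))
include h h' hl hr

/-- Only two arrows change: the one into `s` now enters `y`, and the one into `y` now enters `s`.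
The cycle therefore reads `x → s`, jumps to `y → t → y`, and resumes `s → x`; it is cut at the new
star `t`. -/
theorem merge :
    IsSplitCycle ρ (Sum.inl x) (Sum.inr t) (l₁.map Sum.inl ++ r₁.map Sum.inr)
      (r₂.map Sum.inr ++ l₂.map Sum.inl) where
  path₁ := by
    refine IsPath.append (y := Sum.inr y) ?_ ?_
    · refine h.path₁.map_redirect h.ne_nil₁ h.mid_notMem (fun d _ hd => ?_) fun d _ hd => ?_
      · rw [hl, if_neg hd]
      · rw [hl, if_pos hd]
    · refine h'.path₁.map fun d hd => ?_
      rw [hr, if_neg (h'.path₁.apply_ne_start h'.nodup₁ h'.mid_ne_start hd)]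
  path₂ := by
    refine IsPath.append (y := Sum.inl s) ?_ ?_
    · refine h'.path₂.map_redirect h'.ne_nil₂ h'.start_notMem (fun d _ hd => ?_) fun d _ hd => ?_
      · rw [hr, if_neg hd]
      · rw [hr, if_pos hd]
    · refine h.path₂.map fun d hd => ?_
      rw [hl, if_neg (h.path₂.apply_ne_start h.nodup₂ h.mid_ne_start.symm hd)]
  nodup := by
    -- Up to reordering, these are the two old cycles in disjoint summands.
    have hp : (l₁.map Sum.inl ++ r₁.map Sum.inr ++ (r₂.map Sum.inr ++ l₂.map Sum.inl)).Perm
        ((l₁ ++ l₂).map (Sum.inl : α → α ⊕ β) ++ (r₁ ++ r₂).map Sum.inr) := by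
      rw [← Multiset.coe_eq_coe]
      simp only [List.map_append, ← Multiset.coe_add]
      abel
    refine hp.nodup_iff.2 (List.Nodup.append ?_ ?_ ?_)
    · exact h.nodup.map Sum.inl_injective
    · exact h'.nodup.map Sum.inr_injective
    · intro d hd hd'
      obtain ⟨a, -, rfl⟩ := List.mem_map.1 hd
      obtain ⟨b, -, hb⟩ := List.mem_map.1 hd'
      cases hb
  ne_nil₁ := by simp [h.ne_nil₁]
  ne_nil₂ := by simp [h.ne_nil₂]

/-- The merged cycle contains the root and is not counted, just like the two cycles it replaces; all
other cycles survive unchanged. -/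
theorem ncard_twoCyclePoints_merge [Finite α] [Finite β] :
    (twoCyclePoints ρ (Sum.inl x)).ncard =
      (twoCyclePoints σ x).ncard + (twoCyclePoints τ y).ncard := by
  have hset : twoCyclePoints ρ (Sum.inl x) =
      Sum.inl '' twoCyclePoints σ x ∪ Sum.inr '' twoCyclePoints τ y := by
    ext d
    simp only [twoCyclePoints, Set.mem_ofPred_eq, (h.merge h' hl hr).sameCycle_iff]
    rcases d with d | d
    · simp only [Set.mem_union, Sum.inl_injective.mem_set_image, Set.mem_ofPred_eq,
        h.sameCycle_iff]
      by_cases hd : d ∈ l₁ ∨ d ∈ l₂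
      · rcases hd with hd | hd <;> simp [hd]
      · have e : σ d ≠ s := h.apply_ne_of_notMem hd (Or.inr h.mid_mem)
        have hd' : ¬ (σ d ∈ l₁ ∨ σ d ∈ l₂) :=
          fun hn => h.apply_ne_of_notMem hd hn rfl
        have e' : σ (σ d) ≠ s := h.apply_ne_of_notMem hd' (Or.inr h.mid_mem)
        rw [hl, if_neg e, hl, if_neg e']
        simp
    · simp only [Set.mem_union, Sum.inr_injective.mem_set_image, Set.mem_ofPred_eq,
        h'.sameCycle_iff]
      by_cases hd : d ∈ r₁ ∨ d ∈ r₂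
      · rcases hd with hd | hd <;> simp [hd]
      · have e : τ d ≠ y := h'.apply_ne_of_notMem hd (Or.inl h'.start_mem)
        have hd' : ¬ (τ d ∈ r₁ ∨ τ d ∈ r₂) :=
          fun hn => h'.apply_ne_of_notMem hd hn rfl
        have e' : τ (τ d) ≠ y := h'.apply_ne_of_notMem hd' (Or.inl h'.start_mem)
        rw [hr, if_neg e, hr, if_neg e']
        simp [or_comm]
  have hdisj : Disjoint ((Sum.inl : α → α ⊕ β) '' twoCyclePoints σ x)
      (Sum.inr '' twoCyclePoints τ y) := by
    rw [Set.disjoint_left]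
    rintro _ ⟨a, -, rfl⟩ ⟨b, -, hb⟩
    cases hb
  rw [hset, Set.ncard_union_eq hdisj (Set.toFinite _) (Set.toFinite _),
    Set.ncard_image_of_injective _ Sum.inl_injective,
    Set.ncard_image_of_injective _ Sum.inr_injective]

end Glue

section AddEdge

variable {α : Type*} [DecidableEq α] {σ : Perm α} {x s : α} {l₁ l₂ : List α} {ρ : Perm (α ⊕ Bool)}
  (h : IsSplitCycle σ x s l₁ l₂)
  (hl : ∀ d, ρ (Sum.inl d) = if σ d = x then Sum.inr false else
    if σ d = s then Sum.inr true else Sum.inl (σ d))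
include h hl

theorem isPath_true (ht : ρ (Sum.inr true) = Sum.inl x) :
    IsPath ρ (Sum.inr true) (Sum.inr true :: l₁.map Sum.inl) (Sum.inr true) := by
  refine ⟨rfl, ?_⟩
  rw [ht]
  refine h.path₁.map_redirect h.ne_nil₁ h.mid_notMem (fun d hd hn => ?_) fun d hd hn => ?_
  · rw [hl, if_neg (h.path₁.apply_ne_start h.nodup₁ h.mid_ne_start hd), if_neg hn]
  · rw [hl, if_neg (h.path₁.apply_ne_start h.nodup₁ h.mid_ne_start hd), if_pos hn]

theorem isPath_false (hf : ρ (Sum.inr false) = Sum.inl s) :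
    IsPath ρ (Sum.inr false) (Sum.inr false :: l₂.map Sum.inl) (Sum.inr false) := by
  refine ⟨rfl, ?_⟩
  rw [hf]
  refine h.path₂.map_redirect h.ne_nil₂ h.start_notMem (fun d hd hn => ?_) fun d hd hn => ?_
  · rw [hl, if_neg hn, if_neg (h.path₂.apply_ne_start h.nodup₂ h.mid_ne_start.symm hd)]
  · rw [hl, if_pos hn]

omit [DecidableEq α] h hl in
theorem nodup_inr_cons {b : Bool} {l : List α} (hn : l.Nodup) :
    ((Sum.inr b : α ⊕ Bool) :: l.map Sum.inl).Nodup := by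
  refine List.nodup_cons.2 ⟨?_, hn.map Sum.inl_injective⟩
  intro hd
  obtain ⟨b, -, hb⟩ := List.mem_map.1 hd
  cases hb

/-- Cycles away from `x` survive. Of the two pieces of the old cycle, the one through `true` is the
root face and is not counted; the one through `false` has `l₂.length + 1` points, so it contributes
two points or none. -/
theorem ncard_twoCyclePoints_split [Finite α] (ht : ρ (Sum.inr true) = Sum.inl x)
    (hf : ρ (Sum.inr false) = Sum.inl s) :
    (twoCyclePoints ρ (Sum.inr true)).ncard =
      (twoCyclePoints σ x).ncard + if l₂.length = 1 then 2 else 0 := by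
  have htwo : ∀ d ∈ ((Sum.inr false : α ⊕ Bool) :: l₂.map Sum.inl),
      ((ρ d ≠ d ∧ ρ (ρ d) = d) ↔ l₂.length = 1) := fun d hd => by
    rw [(h.isPath_false hl hf).two_step_iff (by simp) (nodup_inr_cons h.nodup₂) hd]
    simp
  have hset : twoCyclePoints ρ (Sum.inr true) = Sum.inl '' twoCyclePoints σ x ∪
      if l₂.length = 1 then {Sum.inl s, Sum.inr false} else ∅ := by
    ext d
    simp only [twoCyclePoints, Set.mem_ofPred_eq,
      (h.isPath_true hl ht).sameCycle_iff_mem (List.cons_ne_nil _ _)]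
    rcases d with d | d | d
    · simp only [Set.mem_union, Sum.inl_injective.mem_set_image, Set.mem_ofPred_eq,
        h.sameCycle_iff]
      by_cases hd₁ : d ∈ l₁
      · have : d ≠ s := fun e => h.mid_notMem (e ▸ hd₁)
        split_ifs <;> simp [hd₁, this]
      by_cases hd₂ : d ∈ l₂
      · rw [htwo _ (by simp [hd₂])]
        -- A return path of length one consists of `s` alone.
        split_ifs with hlen
        · obtain ⟨a, rfl⟩ := List.length_eq_one_iff.1 hlen
          have : s = a := by simpa using h.mid_mem
          have : d = a := by simpa using hd₂
          simp_all
        · simp [hlen, hd₂]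
      · have hd : ¬ (d ∈ l₁ ∨ d ∈ l₂) := by tauto
        have hd' : ¬ (σ d ∈ l₁ ∨ σ d ∈ l₂) := fun hn => h.apply_ne_of_notMem hd hn rfl
        have hs : d ≠ s := fun e => hd₂ (e ▸ h.mid_mem)
        rw [hl, if_neg (h.apply_ne_of_notMem hd (Or.inl h.start_mem)),
          if_neg (h.apply_ne_of_notMem hd (Or.inr h.mid_mem)), hl,
          if_neg (h.apply_ne_of_notMem hd' (Or.inl h.start_mem)),
          if_neg (h.apply_ne_of_notMem hd' (Or.inr h.mid_mem))]
        split_ifs <;> simp [hd₁, hd₂, hs]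
    · rw [htwo _ (by simp)]
      split_ifs with hlen <;> simp [hlen]
    · split_ifs with hlen <;> simp
  have hdisj : Disjoint ((Sum.inl : α → α ⊕ Bool) '' twoCyclePoints σ x)
      (if l₂.length = 1 then {Sum.inl s, Sum.inr false} else ∅) := by
    split_ifs
    · rw [Set.disjoint_left]
      rintro _ ⟨a, ha, rfl⟩ (e | e)
      · obtain rfl := Sum.inl_injective e
        exact ha.1 (h.sameCycle_iff.2 (Or.inr h.mid_mem))
      · cases e
    · simp
  rw [hset, Set.ncard_union_eq hdisj (Set.toFinite _) (Set.toFinite _),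
    Set.ncard_image_of_injective _ Sum.inl_injective]
  split_ifs
  · rw [Set.ncard_pair (by simp)]
  · simp

end AddEdge

end IsSplitCycle

theorem IsPath.isSplitCycle {α : Type*} {σ : α → α} {x : α} {l : List α} (h : IsPath σ x l x)
    (hn : l.Nodup) {i : ℕ} (hi : 0 < i) (hil : i < l.length) :
    IsSplitCycle σ x (σ^[i] x) (l.take i) (l.drop i) := by
  rw [← List.take_append_drop i l] at h
  obtain ⟨y, h₁, h₂⟩ := IsPath.append_iff.1 h
  have hy := h₁.iterate_eq
  rw [List.length_take, min_eq_left hil.le] at hy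
  subst hy
  refine ⟨h₁, h₂, by rwa [List.take_append_drop], ?_, ?_⟩
  · rw [← List.length_pos_iff, List.length_take]; omega
  · rw [← List.length_pos_iff, List.length_drop]; omega

-- Root-face boundaries of the maps in the construction

/-- The boundary of the root face, from the root dart on, is the list `l`. -/
structure RootedMap.IsBoundary (M : RootedMap) (l : List M.Dart) : Prop where
  path : IsPath M.next M.root l M.root
  nodup : l.Nodup

namespace StarredMap

/-- The boundary of the root face consists of the part `l₁` from the root to the star and of the
part `l₂` from the star to the root, both nonempty. -/
abbrev IsBoundary (M : StarredMap) (l₁ l₂ : List M.Dart) : Prop :=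
  IsSplitCycle M.next M.root M.star l₁ l₂

theorem glue_next_inl (M N : StarredMap) (d : M.Dart) :
    (glue M N).next (Sum.inl d) =
      if M.next d = M.star then Sum.inr N.root else Sum.inl (M.next d) := by
  change swap (Sum.inl M.star) (Sum.inr N.root) (Sum.inl (M.next d)) = _
  simp [swap_apply_def]

theorem glue_next_inr (M N : StarredMap) (d : N.Dart) :
    (glue M N).next (Sum.inr d) =
      if N.next d = N.root then Sum.inl M.star else Sum.inr (N.next d) := by
  change swap (Sum.inl M.star) (Sum.inr N.root) (Sum.inr (N.next d)) = _
  simp [swap_apply_def]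

theorem addRootEdge_next_inl (M : StarredMap) (d : M.Dart) :
    M.addRootEdge.next (Sum.inl d) = if M.next d = M.root then Sum.inr false else
      if M.next d = M.star then Sum.inr true else Sum.inl (M.next d) := by
  change swap (Sum.inl M.star) (Sum.inr true)
    (swap (Sum.inl M.root) (Sum.inr false) (Sum.inl (M.next d))) = _
  simp only [swap_apply_def]
  split_ifs <;> simp_all

/-- If star and root coincided, the second swap would move `inl M.root` again, and the new root dart
would be a face of its own. -/
theorem addRootEdge_next_true (M : StarredMap) (h : M.star ≠ M.root) :
    M.addRootEdge.next (Sum.inr true) = Sum.inl M.root := by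
  change swap (Sum.inl M.star) (Sum.inr true)
    (swap (Sum.inl M.root) (Sum.inr false) (Sum.inr false)) = _
  simp [swap_apply_def, h.symm]

theorem addRootEdge_next_false (M : StarredMap) :
    M.addRootEdge.next (Sum.inr false) = Sum.inl M.star := by
  change swap (Sum.inl M.star) (Sum.inr true)
    (swap (Sum.inl M.root) (Sum.inr false) (Sum.inr true)) = _
  simp [swap_apply_def]

variable {M N : StarredMap} {l₁ l₂ : List M.Dart} {r₁ r₂ : List N.Dart}

theorem IsBoundary.glue (h : M.IsBoundary l₁ l₂) (h' : N.IsBoundary r₁ r₂) :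
    (glue M N).IsBoundary (l₁.map Sum.inl ++ r₁.map Sum.inr) (r₂.map Sum.inr ++ l₂.map Sum.inl) :=
  h.merge h' (glue_next_inl M N) (glue_next_inr M N)

theorem IsBoundary.ncard_internalTwoDarts_glue (h : M.IsBoundary l₁ l₂)
    (h' : N.IsBoundary r₁ r₂) :
    (StarredMap.glue M N).internalTwoDarts.ncard =
      M.internalTwoDarts.ncard + N.internalTwoDarts.ncard :=
  h.ncard_twoCyclePoints_merge h' (glue_next_inl M N) (glue_next_inr M N)

theorem IsBoundary.addRootEdge (h : M.IsBoundary l₁ l₂) :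
    M.addRootEdge.IsBoundary (Sum.inr true :: l₁.map Sum.inl) :=
  ⟨h.isPath_true (addRootEdge_next_inl M) (addRootEdge_next_true M h.mid_ne_start),
    IsSplitCycle.nodup_inr_cons h.nodup₁⟩

theorem IsBoundary.ncard_internalTwoDarts_addRootEdge (h : M.IsBoundary l₁ l₂) :
    M.addRootEdge.internalTwoDarts.ncard =
      M.internalTwoDarts.ncard + if l₂.length = 1 then 2 else 0 :=
  h.ncard_twoCyclePoints_split (addRootEdge_next_inl M) (addRootEdge_next_true M h.mid_ne_start)
    (addRootEdge_next_false M)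

end StarredMap

namespace RootedMap

/-- The strict bounds on `i` keep the star away from the root dart, making both parts nonempty. -/
theorem IsBoundary.mark {M : RootedMap} {l : List M.Dart} (h : M.IsBoundary l) {i : ℕ}
    (hi : 0 < i) (hil : i < l.length) :
    (M.mark i).IsBoundary (l.take i) (l.drop i) := by
  have := h.path.isSplitCycle h.nodup hi hil
  rw [← Perm.coe_pow] at this
  exact this

theorem link_isBoundary : link.IsBoundary [true, false] :=
  ⟨⟨rfl, rfl, rfl⟩, by decide⟩

theorem ncard_internalTwoDarts_link : link.internalTwoDarts.ncard = 0 := by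
  have : link.internalTwoDarts = ∅ := by
    refine Set.eq_empty_iff_forall_notMem.2 fun d hd => hd.1 ?_
    refine (link_isBoundary.path.sameCycle_iff_mem (List.cons_ne_nil _ _)).2 ?_
    exact (by decide : ∀ b : Bool, b ∈ [true, false]) d
  rw [this, Set.ncard_empty]

end RootedMap

-- Counting nodes with a single child of maximum label

namespace LTree

/-- `LTree` is nested through `List`; the second motive of its recursor is taken to be "all members
satisfy `P`". -/
theorem induction {P : LTree → Prop}
    (h : ∀ l cs, (∀ c ∈ cs, P c) → P (node l cs)) (t : LTree) : P t :=
  LTree.rec (motive_1 := P) (motive_2 := fun cs => ∀ c ∈ cs, P c) h (by simp)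
    (fun c cs hc hcs => by simpa using ⟨hc, hcs⟩) t

/-- The nodes that have exactly one child, this child having maximum label. -/
def singleMaxParents (T : LTree) : Set (List ℕ) := {p | T.HasSingleMaxChild p}

/-- The same for a list of siblings, a node being addressed by the position of its ancestor in the
list and its address below this ancestor. -/
def singleMaxParentsIn (cs : List LTree) : Set (List ℕ) :=
  {q | ∃ i p c, q = i :: p ∧ cs[i]? = some c ∧ c.HasSingleMaxChild p}

theorem singleMaxParentsIn_nil : singleMaxParentsIn [] = ∅ := by
  simp [singleMaxParentsIn]

/-- Prepending a sibling shifts the first index of every other address by one, so the two images are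
told apart by their heads. -/
theorem singleMaxParentsIn_cons (c : LTree) (cs : List LTree) :
    singleMaxParentsIn (c :: cs) = List.cons 0 '' c.singleMaxParents ∪
      List.modifyHead (· + 1) '' singleMaxParentsIn cs := by
  ext q
  constructor
  · rintro ⟨i, p, c', rfl, hc, hp⟩
    cases i with
    | zero =>
      obtain rfl : c = c' := by simpa using hc
      exact Or.inl ⟨p, hp, rfl⟩
    | succ i => exact Or.inr ⟨i :: p, ⟨i, p, c', rfl, by simpa using hc, hp⟩, rfl⟩
  · rintro (⟨p, hp, rfl⟩ | ⟨_, ⟨i, p, c', rfl, hc, hp⟩, rfl⟩)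
    · exact ⟨0, p, c, rfl, rfl, hp⟩
    · exact ⟨i + 1, p, c', rfl, by simpa using hc, hp⟩

theorem hasSingleMaxChild_nil (T : LTree) :
    T.HasSingleMaxChild [] ↔ ∃ u, T.children = [u] ∧ u.HasMaxLabel := by
  simp [HasSingleMaxChild, subtreeAt]

theorem hasSingleMaxChild_cons (T : LTree) (i : ℕ) (p : List ℕ) :
    T.HasSingleMaxChild (i :: p) ↔ ∃ c, T.children[i]? = some c ∧ c.HasSingleMaxChild p := by
  simp only [HasSingleMaxChild, subtreeAt, Option.bind_eq_some_iff]
  constructor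
  · rintro ⟨v, u, ⟨c, hc, hv⟩, hu⟩
    exact ⟨c, hc, v, u, hv, hu⟩
  · rintro ⟨c, hc, v, u, hv, hu⟩
    exact ⟨v, u, ⟨c, hc, hv⟩, hu⟩

theorem finite_singleMaxParentsIn {cs : List LTree}
    (h : ∀ c ∈ cs, c.singleMaxParents.Finite) : (singleMaxParentsIn cs).Finite := by
  induction cs with
  | nil => simp [singleMaxParentsIn_nil]
  | cons c cs ih =>
    rw [singleMaxParentsIn_cons]
    exact ((h c (by simp)).image _).union ((ih fun c hc => h c (by simp [hc])).image _)

theorem singleMaxParents_eq (T : LTree) :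
    T.singleMaxParents =
      {p | p = [] ∧ T.HasSingleMaxChild []} ∪ singleMaxParentsIn T.children := by
  ext p
  cases p with
  | nil => simp [singleMaxParents, singleMaxParentsIn]
  | cons i p => simp [singleMaxParents, singleMaxParentsIn, hasSingleMaxChild_cons]

/-- Needed for `ncard` to be meaningful, since it is `0` on infinite sets. -/
theorem finite_singleMaxParents (T : LTree) : T.singleMaxParents.Finite := by
  induction T using LTree.induction with
  | h l cs ih =>
    rw [singleMaxParents_eq]
    exact ((Set.finite_singleton []).subset fun p hp => hp.1).union (finite_singleMaxParentsIn ih)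

theorem ncard_singleMaxParentsIn_cons (c : LTree) (cs : List LTree) :
    (singleMaxParentsIn (c :: cs)).ncard =
      c.singleMaxParents.ncard + (singleMaxParentsIn cs).ncard := by
  have hfin : (singleMaxParentsIn cs).Finite :=
    finite_singleMaxParentsIn fun c _ => c.finite_singleMaxParents
  rw [singleMaxParentsIn_cons, Set.ncard_union_eq _ (c.finite_singleMaxParents.image _)
    (hfin.image _), Set.ncard_image_of_injective _ List.cons_injective, Set.InjOn.ncard_image]
  · rintro _ ⟨i, p, _, rfl, -⟩ _ ⟨j, q, _, rfl, -⟩ h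
    simpa using h
  · rw [Set.disjoint_left]
    rintro _ ⟨p, -, rfl⟩ ⟨_, ⟨i, q, _, rfl, -⟩, h⟩
    simp at h

open Classical in
theorem ncard_singleMaxParents (T : LTree) :
    T.singleMaxParents.ncard = (singleMaxParentsIn T.children).ncard +
      if T.HasSingleMaxChild [] then 1 else 0 := by
  have hfin : (singleMaxParentsIn T.children).Finite :=
    finite_singleMaxParentsIn fun c _ => c.finite_singleMaxParents
  rw [singleMaxParents_eq]
  split_ifs with h
  · have hnil : [] ∉ singleMaxParentsIn T.children := by simp [singleMaxParentsIn]
    have : {p : List ℕ | p = [] ∧ T.HasSingleMaxChild []} = {[]} := by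
      ext p; simp [h]
    rw [this, Set.singleton_union, Set.ncard_insert_of_notMem hnil hfin]
  · simp [h]

/-- An only child has address `p ++ [0]`, which determines its parent `p`. -/
theorem ncard_isSingleMaxChild (T : LTree) :
    {q | T.IsSingleMaxChild q}.ncard = T.singleMaxParents.ncard := by
  have : {q | T.IsSingleMaxChild q} = (· ++ [0]) '' T.singleMaxParents := by
    ext q
    constructor
    · rintro ⟨p, rfl, hp⟩
      exact ⟨p, hp, rfl⟩
    · rintro ⟨p, hp, rfl⟩
      exact ⟨p, rfl, hp⟩
  rw [this, Set.ncard_image_of_injective _ (List.append_left_injective [0])]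

-- The induction on the tree

/-- The largest label that a node with these children can have. -/
def maxLabel (t : LTree) : ℕ := if t.children = [] then 1 else t.childSum

theorem hasMaxLabel_iff (t : LTree) : t.HasMaxLabel ↔ t.label = t.maxLabel := by
  unfold HasMaxLabel maxLabel
  split_ifs <;> rfl

/-- All nodes below the root have labels between `1` and the maximum. -/
def HasInnerLabels (T : LTree) : Prop :=
  ∀ p t, p ≠ [] → T.subtreeAt p = some t → 0 < t.label ∧ t.label ≤ t.maxLabel

/-- `IsBetaTree` does not pass to subtrees, whose roots may have less than the full sum. Bounds
strictly below the root do pass, and suffice because `toMap` ignores the root label. -/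
theorem IsBetaTree.hasInnerLabels {T : LTree} (h : T.IsBetaTree) : T.HasInnerLabels := by
  intro p t hp ht
  refine ⟨h.pos p t ht, ?_⟩
  unfold maxLabel
  split_ifs with hc
  · exact (h.leaf p t ht hc).le
  · exact h.le p t hp ht hc

theorem HasInnerLabels.of_mem {T c : LTree} (h : T.HasInnerLabels) (hc : c ∈ T.children) :
    c.HasInnerLabels ∧ 0 < c.label ∧ c.label ≤ c.maxLabel := by
  obtain ⟨i, hi⟩ := List.mem_iff_getElem?.1 hc
  constructor
  · intro p t _ ht
    exact h (i :: p) t (by simp) (by simpa [subtreeAt, hi] using ht)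
  · exact h [i] c (by simp) (by simp [subtreeAt, hi])

/-- What the construction preserves: the degree of the root face of the map of `T`, and the number
of its darts on internal `2`-faces. -/
def MapInvariant (T : LTree) : Prop :=
  (∃ l, T.toMap.IsBoundary l ∧ l.length = T.maxLabel + 1) ∧
    T.toMap.internalTwoDarts.ncard = 2 * T.singleMaxParents.ncard

/-- The return path has length `c.maxLabel + 1 - c.label`, which is one exactly when the label is
maximal. -/
theorem MapInvariant.mark {c : LTree} (h : c.MapInvariant) (hpos : 0 < c.label)
    (hle : c.label ≤ c.maxLabel) :
    ∃ l₁ l₂, (c.toMap.mark c.label).IsBoundary l₁ l₂ ∧ l₁.length = c.label ∧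
      (l₂.length = 1 ↔ c.HasMaxLabel) := by
  obtain ⟨⟨l, hl, hlen⟩, -⟩ := h
  refine ⟨_, _, hl.mark hpos (by omega), ?_, ?_⟩
  · have ht : (l.take c.label).length = c.label := by
      rw [List.length_take]; omega
    exact ht
  · have hd : (l.drop c.label).length = 1 ↔ c.HasMaxLabel := by
      rw [List.length_drop, hasMaxLabel_iff]; omega
    exact hd

/-- Forward lengths add up to the sum of the labels. Return lengths add too, and each is at least
one, so a total of one forces a single child. -/
theorem glueChain_invariant (c : LTree) (cs : List LTree)
    (h : ∀ d ∈ c :: cs, d.MapInvariant ∧ 0 < d.label ∧ d.label ≤ d.maxLabel) :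
    (∃ l₁ l₂, (StarredMap.glueChain (c.toMap.mark c.label) (starredMaps cs)).IsBoundary l₁ l₂ ∧
      l₁.length = ((c :: cs).map label).sum ∧
      (l₂.length = 1 ↔ ∃ u, c :: cs = [u] ∧ u.HasMaxLabel)) ∧
    (StarredMap.glueChain (c.toMap.mark c.label) (starredMaps cs)).internalTwoDarts.ncard =
      2 * (singleMaxParentsIn (c :: cs)).ncard := by
  obtain ⟨hinv, hpos, hle⟩ := h c (by simp)
  obtain ⟨l₁, l₂, hl, hlen, hmax⟩ := hinv.mark hpos hle
  have hcount : (c.toMap.mark c.label).internalTwoDarts.ncard = 2 * c.singleMaxParents.ncard :=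
    hinv.2
  induction cs generalizing c l₁ l₂ with
  | nil =>
    refine ⟨⟨l₁, l₂, hl, hlen.trans (by simp), hmax.trans (by simp)⟩, ?_⟩
    rw [ncard_singleMaxParentsIn_cons, singleMaxParentsIn_nil, Set.ncard_empty, add_zero]
    exact hcount
  | cons d cs ih =>
    obtain ⟨hinv', hpos', hle'⟩ := h d (by simp)
    obtain ⟨r₁, r₂, hr, hlen', hmax'⟩ := hinv'.mark hpos' hle'
    obtain ⟨⟨s₁, s₂, hs, hslen, -⟩, hscount⟩ :=
      ih d (fun e he => h e (by simp_all)) hinv' hpos' hle' r₁ r₂ hr hlen' hmax' hinv'.2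
    refine ⟨⟨_, _, StarredMap.IsBoundary.glue hl hs, ?_, ?_⟩, ?_⟩
    · refine (List.length_append).trans ?_
      refine (congrArg₂ (· + ·) ((List.length_map _).trans hlen) ((List.length_map _).trans hslen)).trans ?_
      simp
    · have h₁ := List.length_pos_iff.2 hl.ne_nil₂
      have h₂ := List.length_pos_iff.2 hs.ne_nil₂
      refine iff_of_false (fun e => ?_) (by simp)
      have e' : s₂.length + l₂.length = 1 :=
        ((List.length_append.trans (congrArg₂ _ (List.length_map _) (List.length_map _))).symm).trans e
      omega
    · refine (StarredMap.IsBoundary.ncard_internalTwoDarts_glue hl hs).trans ?_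
      rw [hcount, hscount, ncard_singleMaxParentsIn_cons c]
      ring

theorem HasInnerLabels.mapInvariant {T : LTree} (h : T.HasInnerLabels) : T.MapInvariant := by
  classical
  induction T using LTree.induction with
  | h l cs ih =>
    cases cs with
    | nil =>
      -- For a leaf both darts of the link lie on the root face: its degree is `1 + 1`, and no
      -- internal face exists.
      refine ⟨⟨[true, false], RootedMap.link_isBoundary, rfl⟩, ?_⟩
      refine RootedMap.ncard_internalTwoDarts_link.trans ?_
      rw [ncard_singleMaxParents, hasSingleMaxChild_nil]
      simp [children, singleMaxParentsIn_nil]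
    | cons c cs =>
      obtain ⟨⟨l₁, l₂, hl, hlen, hmax⟩, hcount⟩ := glueChain_invariant c cs fun d hd =>
        ⟨ih d hd (h.of_mem hd).1, (h.of_mem hd).2⟩
      refine ⟨⟨_, hl.addRootEdge, ?_⟩, ?_⟩
      · exact List.length_cons.trans (congrArg (· + 1) ((List.length_map _).trans hlen))
      · refine hl.ncard_internalTwoDarts_addRootEdge.trans ?_
        rw [hcount, ncard_singleMaxParents, hasSingleMaxChild_nil]
        simp only [children, hmax]
        by_cases hu : ∃ u, c :: cs = [u] ∧ u.HasMaxLabel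
        · simp only [hu, if_true]; ring
        · simp only [hu, if_false]; ring

theorem IsBetaTree.ncard_internalTwoFaces {T : LTree} (hT : T.IsBetaTree) {M : RootedMap}
    (hM : T.CorrespondsTo M) :
    M.internalTwoFaces.ncard = T.singleMaxParents.ncard := by
  have h := hT.hasInnerLabels.mapInvariant.2
  rw [RootedMap.ncard_internalTwoDarts] at h
  rw [hM.ncard_internalTwoFaces]
  omega

end LTree

theorem proposition2 (T : LTree) (hT : T.IsBetaTree) :
    (T.IsPrimitive ↔ ¬ ∃ p : List ℕ, T.HasSingleMaxChild p) ∧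
    ∀ M : RootedMap, T.CorrespondsTo M →
      M.internalTwoFaces.ncard = {q : List ℕ | T.IsSingleMaxChild q}.ncard := by
  -- The count is invariant under isomorphism, so every map corresponding to `T` gives the same
  -- answer, and `T.toMap` itself can serve as the witness for primitivity.
  have hprim : ∀ M, T.CorrespondsTo M →
      (M.IsPrimitive ↔ ¬ ∃ p : List ℕ, T.HasSingleMaxChild p) := fun M hM => by
    rw [RootedMap.IsPrimitive, ← Set.ncard_eq_zero (Set.toFinite _), hT.ncard_internalTwoFaces hM,
      Set.ncard_eq_zero T.finite_singleMaxParents, Set.eq_empty_iff_forall_notMem, not_exists]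
    rfl
  refine ⟨⟨fun ⟨M, hM, h⟩ => (hprim M hM).1 h, fun h => ?_⟩, fun M hM => ?_⟩
  · have hM : T.CorrespondsTo T.toMap := ⟨Equiv.refl _, fun _ => rfl, fun _ => rfl, rfl⟩
    exact ⟨_, hM, (hprim _ hM).2 h⟩
  · rw [T.ncard_isSingleMaxChild, hT.ncard_internalTwoFaces hM]
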